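/- Let $R$ be an infinite integral domain. Let $\beta(R\setminus\{0\})$ be the set of ultrafilters on $R\setminus\{0\}$ (identified with the ultrafilters on $R$ other than the principal one at $0$), made into a semigroup by $$A\in p\cdot q\iff \{s\in R\setminus\{0\} : \{t\in R\setminus\{0\} : st\in A\}\in q\}\in p ,$$ let $K$ be its smallest ideal, i.e. the nonempty two-sided ideal contained in every nonempty two-sided ideal, and let $p\in K$ be an idempotent, $p\cdot p=p$. Then: (i) For every $A\in p$ and every $\ell\in\mathbb{N}$ there exist $b,g\in A$ with $\{bg^j\}_{j=0}^{\ell}\subseteq A$. (ii) For every $A\in p$ and every finite homogeneous linear system $\mathbf{M}\vec{x}=\vec{0}$ with coefficients in $R$ that is partition regular over $R\setminus\{0\}$ (that is, for every finite partition of $R\setminus\{0\}$ some cell contains all the entries of a solution), there is a solution $\vec{x}$ of the system all of whose entries lie in $A$. (iii) For every $r\in R\setminus\{0\}$ we have $rR\in p$ (that is, $rR\setminus\{0\}$ belongs to $p$). (iv) For every $A\in p$, $\ell\in\mathbb{N}$ and $h,j_1,\dots,j_\ell\in R\setminus\{0\}$ there exist $a,d\in R$ with $\{hd,ha\}\cup\{ha+j_id\}_{i=1}^{\ell}\subseteq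 A$. -/

import Mathlib

/-! ### Ideals, the smallest ideal and idempotents of a semigroup -/

/-- A (two-sided) ideal of a semigroup: a nonempty set closed under multiplication
by arbitrary elements on both sides. -/
structure IsSemigroupIdeal {S : Type*} [Semigroup S] (I : Set S) : Prop where
  nonempty : I.Nonempty
  mul_left_mem : ∀ (s : S) {x : S}, x ∈ I → s * x ∈ I
  mul_right_mem : ∀ (s : S) {x : S}, x ∈ I → x * s ∈ I

/-- `K(S)`: the intersection of all ideals. It is the smallest ideal of `S` whenever `S` has one,
in particular for the semigroups `βS` (see `isSemigroupIdeal_smallestIdeal`). -/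
def smallestIdeal (S : Type*) [Semigroup S] : Set S :=
  {x | ∀ I : Set S, IsSemigroupIdeal I → x ∈ I}

/-- `E(T)`: the idempotents of the semigroup that lie in the subset `T`. -/
def idempotentsIn {S : Type*} [Semigroup S] (T : Set S) : Set S :=
  {e | e ∈ T ∧ e * e = e}

/-! ### The semigroup `βS`

`βS` is `Ultrafilter S`, with `A ∈ p * q ↔ {s | {t | s * t ∈ A} ∈ q} ∈ p`. -/

attribute [local instance] Ultrafilter.semigroup

/-- The description of the product of `βS`. -/
theorem mem_ultrafilter_mul_iff {S : Type*} [Semigroup S] (p q : Ultrafilter S) (A : Set S) :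
    A ∈ p * q ↔ {s : S | {t : S | s * t ∈ A} ∈ q} ∈ p :=
  Ultrafilter.eventually_mul p q (fun x => x ∈ A)

/-- `βS` has a smallest ideal, namely `smallestIdeal (Ultrafilter S)`. -/
theorem isSemigroupIdeal_smallestIdeal (S : Type*) [Semigroup S] [Nonempty S] :
    IsSemigroupIdeal (smallestIdeal (Ultrafilter S)) := by
  refine ⟨?_, fun s x hx I hI => hI.mul_left_mem s (hx I hI),
    fun s x hx I hI => hI.mul_right_mem s (hx I hI)⟩
  -- a minimal closed left ideal is contained in every ideal
  let F : Set (Set (Ultrafilter S)) :=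
    {L | IsClosed L ∧ L.Nonempty ∧ ∀ (s : Ultrafilter S), ∀ x ∈ L, s * x ∈ L}
  have hF : ∃ L, Minimal (· ∈ F) L := by
    apply zorn_superset
    intro c hcF hc
    rcases c.eq_empty_or_nonempty with rfl | hne
    · exact ⟨Set.univ, ⟨isClosed_univ, ⟨pure (Classical.arbitrary S), trivial⟩, by simp⟩, by simp⟩
    · refine ⟨⋂₀ c, ⟨isClosed_sInter fun t ht => (hcF ht).1, ?_, ?_⟩,
        fun s hs => Set.sInter_subset_of_mem hs⟩
      · have := hne.to_subtype
        rw [Set.sInter_eq_iInter]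
        exact IsCompact.nonempty_iInter_of_directed_nonempty_isCompact_isClosed _
          (DirectedOn.directed_val (IsChain.directedOn hc.symm))
          (fun i => (hcF i.2).2.1) (fun i => (hcF i.2).1.isCompact) (fun i => (hcF i.2).1)
      · exact fun s x hx t ht => (hcF ht).2.2 s x (hx t ht)
  obtain ⟨L, hL⟩ := hF
  obtain ⟨-, ⟨y, hy⟩, hLmul⟩ := hL.1
  refine ⟨y, fun I hI => ?_⟩
  obtain ⟨z, hz⟩ := hI.nonempty
  have hzy : z * y ∈ L := hLmul z y hy
  have hsub : Set.range (· * (z * y)) ⊆ L := by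
    rintro _ ⟨s, rfl⟩
    exact hLmul s _ hzy
  have hmem : Set.range (· * (z * y)) ∈ F := by
    refine ⟨(isCompact_range (Ultrafilter.continuous_mul_left (z * y))).isClosed,
      ⟨_, ⟨z, rfl⟩⟩, ?_⟩
    rintro s _ ⟨t, rfl⟩
    exact ⟨s * t, mul_assoc s t _⟩
  obtain ⟨s, hs⟩ := hL.2 hmem hsub hy
  rw [← hs]
  exact hI.mul_left_mem s (hI.mul_right_mem y hz)

/-! ### The multiplicative semigroup `R ∖ {0}` and partition regular systems -/

/-- The multiplicative semigroup `(R ∖ {0}, ·)` of an integral domain. -/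
def nonzeroElements (R : Type*) [CommRing R] [IsDomain R] : Submonoid R where
  carrier := {x | x ≠ 0}
  mul_mem' := fun hx hy => mul_ne_zero hx hy
  one_mem' := one_ne_zero

/-- The system `f 0 x = 0, …, f (k - 1) x = 0` in the unknowns `x : Fin n → S` is partition regular
over `S`: every finite partition of `S` has a cell that contains a solution. -/
def IsPartitionRegular {S R : Type*} [Zero R] {k n : ℕ} (f : Fin k → (Fin n → S) → R) : Prop :=
  ∀ (r : ℕ) (C : Fin r → Set S), Pairwise (fun i j => Disjoint (C i) (C j)) →
    (⋃ i, C i) = Set.univ →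
      ∃ i, ∃ x : Fin n → S, (∀ j, x j ∈ C i) ∧ ∀ e, f e x = 0

/-- The homogeneous linear system `M x = 0` with coefficients in `R` and unknowns in `R ∖ {0}`. -/
def homogeneousSystem {R : Type*} [CommRing R] [IsDomain R] {m n : ℕ}
    (M : Matrix (Fin m) (Fin n) R) : Fin m → (Fin n → nonzeroElements R) → R :=
  fun e x => ∑ j, M e j * (x j : R)

open Filter Combinatorics

/-! ### Choosing finitely many members of ultrafilters -/

/-- Compactness of `βS`: choosing a member from every ultrafilter, finitely many of the chosen sets
cover the underlying type. -/
theorem exists_finset_ultrafilter_cover {S : Type*} (A : Ultrafilter S → Set S)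
    (hA : ∀ q, A q ∈ q) : ∃ t : Finset (Ultrafilter S), ∀ x, ∃ q ∈ t, x ∈ A q := by
  obtain ⟨t, -, ht⟩ := (isCompact_univ (X := Ultrafilter S)).elim_nhds_subcover
    (fun q => {u | A q ∈ u}) fun q _ => (ultrafilter_isOpen_basic (A q)).mem_nhds (hA q)
  refine ⟨t, fun x => ?_⟩
  simpa using ht (Set.mem_univ (pure x : Ultrafilter S))

/-! ### The smallest ideal of `βS` -/

/-- A semigroup of ultrafilters has a minimal closed left ideal, and each of its elements `x`
satisfies `x ∈ βS * q * x` for every `q`. -/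
theorem exists_forall_exists_mul_mul_eq_self (S : Type*) [Semigroup S] [Nonempty S] :
    ∃ x : Ultrafilter S, ∀ q : Ultrafilter S, ∃ r : Ultrafilter S, r * (q * x) = x := by
  let F : Set (Set (Ultrafilter S)) :=
    {L | IsClosed L ∧ L.Nonempty ∧ ∀ (s : Ultrafilter S), ∀ x ∈ L, s * x ∈ L}
  have hF : ∃ L, Minimal (· ∈ F) L := by
    apply zorn_superset
    intro c hcF hc
    rcases c.eq_empty_or_nonempty with rfl | hne
    · exact ⟨Set.univ, ⟨isClosed_univ, ⟨pure (Classical.arbitrary S), trivial⟩, by simp⟩, by simp⟩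
    · refine ⟨⋂₀ c, ⟨isClosed_sInter fun t ht => (hcF ht).1, ?_, ?_⟩,
        fun s hs => Set.sInter_subset_of_mem hs⟩
      · have := hne.to_subtype
        rw [Set.sInter_eq_iInter]
        exact IsCompact.nonempty_iInter_of_directed_nonempty_isCompact_isClosed _
          (DirectedOn.directed_val (IsChain.directedOn hc.symm))
          (fun i => (hcF i.2).2.1) (fun i => (hcF i.2).1.isCompact) (fun i => (hcF i.2).1)
      · exact fun s x hx t ht => (hcF ht).2.2 s x (hx t ht)
  obtain ⟨L, hL⟩ := hF
  obtain ⟨-, ⟨x, hx⟩, hLmul⟩ := hL.1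
  refine ⟨x, fun q => ?_⟩
  have hmem : Set.range (· * (q * x)) ∈ F := by
    refine ⟨(isCompact_range (Ultrafilter.continuous_mul_left (q * x))).isClosed,
      ⟨_, ⟨q, rfl⟩⟩, ?_⟩
    rintro s _ ⟨t, rfl⟩
    exact ⟨s * t, mul_assoc s t _⟩
  refine hL.2 hmem ?_ hx
  rintro _ ⟨s, rfl⟩
  exact hLmul s _ (hLmul q x hx)

/-- Each element `p` of the smallest ideal of `βS` lies in a minimal left ideal:
`p ∈ βS * q * p` for every `q`. -/
theorem exists_mul_mul_eq_self {S : Type*} [Semigroup S] [Nonempty S] {p : Ultrafilter S}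
    (hp : p ∈ smallestIdeal (Ultrafilter S)) (q : Ultrafilter S) :
    ∃ r : Ultrafilter S, r * (q * p) = p := by
  refine hp {x | ∀ q : Ultrafilter S, ∃ r : Ultrafilter S, r * (q * x) = x}
    ⟨exists_forall_exists_mul_mul_eq_self S, fun s x hx q => ?_, fun s x hx q => ?_⟩ q
  · obtain ⟨r, hr⟩ := hx (q * s)
    exact ⟨s * r, by rw [mul_assoc, ← mul_assoc q, hr]⟩
  · obtain ⟨r, hr⟩ := hx q
    exact ⟨r, by rw [← mul_assoc, ← mul_assoc, mul_assoc r, hr]⟩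

/-- If `A` is a member of an element `p` of the smallest ideal of `βS`, then
`{s | s⁻¹A ∈ p}` is syndetic. -/
theorem exists_finset_mul_mem {S : Type*} [Semigroup S] [Nonempty S] {p : Ultrafilter S}
    (hp : p ∈ smallestIdeal (Ultrafilter S)) {A : Set S} (hA : A ∈ p) :
    ∃ F : Finset S, ∀ t, ∃ f ∈ F, {s | f * t * s ∈ A} ∈ p := by
  classical
  have key : ∀ q : Ultrafilter S, ∃ f : S, {t | {s | f * t * s ∈ A} ∈ p} ∈ q := by
    intro q
    obtain ⟨r, hr⟩ := exists_mul_mul_eq_self hp q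
    rw [← hr, mem_ultrafilter_mul_iff] at hA
    obtain ⟨f, hf⟩ := r.nonempty_of_mem hA
    refine ⟨f, ?_⟩
    simpa only [Set.mem_ofPred_eq, mem_ultrafilter_mul_iff, mul_assoc] using hf
  choose f hf using key
  obtain ⟨t, ht⟩ := exists_finset_ultrafilter_cover _ hf
  refine ⟨t.image f, fun x => ?_⟩
  obtain ⟨q, hq, hx⟩ := ht x
  exact ⟨f q, Finset.mem_image_of_mem f hq, hx⟩

/-! ### Translation invariant partition regular families -/

/-- Let `P` be a family of finite configurations in a commutative semigroup `S` which is invariant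
under translations, such that every finite partition of `S` has a cell containing a configuration.
Then every member of every element of the smallest ideal of `βS` contains a configuration. -/
theorem exists_config_of_mem_smallestIdeal {S ι : Type*} [CommSemigroup S] [Nonempty S] [Finite ι]
    (P : (ι → S) → Prop) (hmul : ∀ s x, P x → P fun j => s * x j)
    (hP : ∀ (r : ℕ) (C : Fin r → Set S), Pairwise (fun i j => Disjoint (C i) (C j)) →
      (⋃ i, C i) = Set.univ → ∃ i, ∃ x : ι → S, (∀ j, x j ∈ C i) ∧ P x)
    {p : Ultrafilter S} (hp : p ∈ smallestIdeal (Ultrafilter S)) {A : Set S} (hA : A ∈ p) :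
    ∃ x : ι → S, (∀ j, x j ∈ A) ∧ P x := by
  refine hp {q | ∀ A ∈ q, ∃ x : ι → S, (∀ j, x j ∈ A) ∧ P x} ⟨?_, fun r q hq A hA => ?_,
    fun r q hq A hA => ?_⟩ A hA
  · by_contra! hcon
    have hcon' : ∀ q : Ultrafilter S, ∃ A ∈ q, ∀ x : ι → S, (∀ j, x j ∈ A) → ¬ P x := by
      intro q
      have hq : q ∉ {q : Ultrafilter S | ∀ A ∈ q, ∃ x : ι → S, (∀ j, x j ∈ A) ∧ P x} := by
        simp [hcon]
      simpa using hq
    choose B hBq hB using hcon'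
    obtain ⟨t, ht⟩ := exists_finset_ultrafilter_cover B hBq
    choose c hct hc using ht
    let e := t.equivFin
    obtain ⟨i, x, hx, hPx⟩ := hP t.card (fun i => {s | e ⟨c s, hct s⟩ = i})
      (fun i j hij => Set.disjoint_left.2 fun s (hi : _ = i) (hj : _ = j) => hij (hi.symm.trans hj))
      (by ext s; simp)
    refine hB (e.symm i) x (fun j => ?_) hPx
    have hxj : e ⟨c (x j), hct (x j)⟩ = i := hx j
    rw [← hxj, e.symm_apply_apply]
    exact hc (x j)
  · rw [mem_ultrafilter_mul_iff] at hA
    obtain ⟨s, hs⟩ := r.nonempty_of_mem hA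
    obtain ⟨x, hx, hPx⟩ := hq _ hs
    exact ⟨fun j => s * x j, hx, hmul s x hPx⟩
  · rw [mem_ultrafilter_mul_iff] at hA
    obtain ⟨x, hx, hPx⟩ := hq _ hA
    obtain ⟨s, hs⟩ := r.nonempty_of_mem (iInter_mem.2 hx)
    exact ⟨fun j => s * x j, fun j => by simpa [mul_comm] using Set.mem_iInter.1 hs j,
      hmul s x hPx⟩

/-! ### Consequences of the Hales–Jewett theorem -/

/-- The Hales–Jewett theorem for products over words in a commutative monoid. -/
@[to_additive /-- The Hales–Jewett theorem for sums over words in a commutative monoid. -/]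
theorem exists_mono_prod (α κ : Type*) [Finite α] [Finite κ] :
    ∃ (ι : Type) (_ : Fintype ι), ∀ {M : Type*} [CommMonoid M] (φ : ι → α → M) (C : M → κ),
      ∃ U : Finset ι, U.Nonempty ∧ ∃ (b : M) (c : κ), ∀ x, C (b * ∏ i ∈ U, φ i x) = c := by
  classical
  obtain ⟨ι, hι, h⟩ := Line.exists_mono_in_high_dimension α κ
  refine ⟨ι, hι, fun {M} _ φ C => ?_⟩
  obtain ⟨l, c, hl⟩ := h fun v => C (∏ i, φ i (v i))
  let U : Finset ι := {i | l.idxFun i = none}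
  refine ⟨U, ?_, ∏ i ∈ Uᶜ, (l.idxFun i).elim 1 (φ i), c, fun x => ?_⟩
  · obtain ⟨i, hi⟩ := l.proper
    exact ⟨i, by simpa [U] using hi⟩
  · rw [← hl x]
    dsimp only
    rw [← Finset.prod_compl_mul_prod U]
    congr 2
    · refine Finset.prod_congr rfl fun i hi => ?_
      obtain ⟨y, hy⟩ := Option.ne_none_iff_exists'.1 (by simpa [U] using hi)
      rw [hy, l.apply_some hy, Option.elim_some]
    · refine Finset.prod_congr rfl fun i hi => ?_
      rw [l.apply_none x i (by simpa [U] using hi)]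

/-- In an infinite integral domain there are arbitrarily many elements all of whose nonempty sums
are nonzero. -/
theorem exists_forall_sum_ne_zero (R ι : Type*) [CommRing R] [IsDomain R] [Infinite R]
    [Fintype ι] : ∃ y : ι → R, ∀ U : Finset ι, U.Nonempty → ∑ i ∈ U, y i ≠ 0 := by
  classical
  let P : MvPolynomial ι R :=
    ∏ U ∈ Finset.univ.filter (fun U : Finset ι => U.Nonempty), ∑ i ∈ U, MvPolynomial.X i
  have hP : P ≠ 0 := by
    refine Finset.prod_ne_zero_iff.2 fun U hU h0 => ?_
    obtain ⟨i, hi⟩ := (Finset.mem_filter.1 hU).2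
    have := congrArg (MvPolynomial.eval (Pi.single i (1 : R))) h0
    simp [Pi.single_apply, hi] at this
  obtain ⟨y, hy⟩ : ∃ y : ι → R, MvPolynomial.eval y P ≠ 0 := by
    by_contra! h
    exact hP (MvPolynomial.funext fun y => by simpa using h y)
  refine ⟨y, fun U hU => ?_⟩
  simp only [P, map_prod, map_sum, MvPolynomial.eval_X] at hy
  exact Finset.prod_ne_zero_iff.1 hy U (by simpa using hU)

/-- Van der Waerden's theorem in an infinite integral domain, with a nonzero ratio. -/
theorem exists_mono_affine {R κ : Type*} [CommRing R] [IsDomain R] [Infinite R] [Finite κ]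
    (C : R → κ) (J : Finset R) : ∃ a d : R, d ≠ 0 ∧ ∃ c, ∀ j ∈ J, C (a + j * d) = c := by
  obtain ⟨ι, _, h⟩ := exists_mono_sum J κ
  obtain ⟨y, hy⟩ := exists_forall_sum_ne_zero R ι
  obtain ⟨U, hU, b, c, hc⟩ := h (fun i x => (x : R) * y i) C
  refine ⟨b, ∑ i ∈ U, y i, hy U hU, c, fun j hj => ?_⟩
  rw [Finset.mul_sum]
  exact hc ⟨j, hj⟩

/-! ### Geometric progressions -/

/-- Members of an idempotent in the smallest ideal of `βS` contain arbitrarily long geometric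
progressions together with their ratio. -/
theorem exists_geometric_progression {S : Type*} [CommMonoid S] {p : Ultrafilter S}
    (hp : p ∈ smallestIdeal (Ultrafilter S)) (hpp : p * p = p) {A : Set S} (hA : A ∈ p) (ℓ : ℕ) :
    ∃ b ∈ A, ∃ g ∈ A, ∀ j ≤ ℓ, b * g ^ j ∈ A := by
  obtain ⟨F, hF⟩ := exists_finset_mul_mem hp hA
  choose c hcF hc using hF
  obtain ⟨a, ha⟩ := Hindman.exists_FP_of_large p hpp A hA
  obtain ⟨ι, _, h⟩ := exists_mono_prod (Fin (ℓ + 1)) F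
  let e : ι ↪ ℕ := (Fintype.equivFin ι).toEmbedding.trans Fin.valEmbedding
  obtain ⟨U, hU, b, f, hf⟩ := h (fun i j => a.get (e i) ^ (j : ℕ)) fun t => ⟨c t, hcF t⟩
  let g := ∏ i ∈ U, a.get (e i)
  have hg : g ∈ A := by
    have := Hindman.FP.finsetProd a (U.map e) (hU.map)
    rw [Finset.prod_map] at this
    exact ha this
  have hmem : ∀ j : Fin (ℓ + 1), {s | f * (b * g ^ (j : ℕ)) * s ∈ A} ∈ p := by
    intro j
    have := hc (b * g ^ (j : ℕ))
    have hfj := congrArg Subtype.val (hf j)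
    rw [Finset.prod_pow] at hfj
    rwa [show c (b * g ^ (j : ℕ)) = f from hfj] at this
  obtain ⟨s, hs⟩ := p.nonempty_of_mem (iInter_mem.2 hmem)
  have hs' : ∀ j ≤ ℓ, f * b * s * g ^ j ∈ A := by
    intro j hj
    have := Set.mem_iInter.1 hs ⟨j, Nat.lt_succ_of_le hj⟩
    rw [Set.mem_ofPred_eq] at this
    convert this using 1
    rw [← mul_assoc, mul_right_comm]
  exact ⟨f * b * s, by simpa using hs' 0 (Nat.zero_le _), g, hg, hs'⟩

/-! ### The multiplicative semigroup of an infinite integral domain -/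

section Domain

variable {R : Type*} [CommRing R] [IsDomain R]

/-- The solutions of a homogeneous system are invariant under scaling. -/
theorem homogeneousSystem_smul {m n : ℕ} (M : Matrix (Fin m) (Fin n) R) (e : Fin m)
    (s : nonzeroElements R) (x : Fin n → nonzeroElements R) :
    homogeneousSystem M e (fun j => s * x j) = s * homogeneousSystem M e x := by
  simp only [homogeneousSystem, Submonoid.coe_mul, Finset.mul_sum]
  exact Finset.sum_congr rfl fun j _ => mul_left_comm _ _ _

/-- Elements of the smallest ideal contain the multiples of each nonzero element. -/
theorem setOf_dvd_mem {p : Ultrafilter (nonzeroElements R)}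
    (hp : p ∈ smallestIdeal (Ultrafilter (nonzeroElements R))) (r : nonzeroElements R) :
    {s | r ∣ s} ∈ p := by
  refine hp {q | {s | r ∣ s} ∈ q} ⟨⟨pure r, ?_⟩, fun q x hx => ?_, fun q x hx => ?_⟩
  · exact Ultrafilter.mem_pure.2 (dvd_refl r)
  · refine (mem_ultrafilter_mul_iff _ _ _).2 (univ_mem' fun s => ?_)
    exact mem_of_superset hx fun t ht => Dvd.dvd.mul_left ht s
  · refine (mem_ultrafilter_mul_iff _ _ _).2 (mem_of_superset hx fun s hs => ?_)
    exact univ_mem' fun t => Dvd.dvd.mul_right hs t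

variable [Infinite R]

/-- Members of elements of the multiplicative smallest ideal satisfy the conclusion of
van der Waerden's theorem. -/
theorem exists_affine_mem {p : Ultrafilter (nonzeroElements R)}
    (hp : p ∈ smallestIdeal (Ultrafilter (nonzeroElements R))) {A : Set (nonzeroElements R)}
    (hA : A ∈ p) (J : Finset R) :
    ∃ (a : R) (d : nonzeroElements R), ∀ j ∈ J, a + j * d ∈ Subtype.val '' A := by
  classical
  obtain ⟨F, hF⟩ := exists_finset_mul_mem hp hA
  choose c hcF hc using hF
  let C : R → Option F := fun t => if ht : t ≠ 0 then some ⟨c ⟨t, ht⟩, hcF _⟩ else none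
  obtain ⟨a, d, hd, k, hk⟩ := exists_mono_affine C (insert 0 (insert 1 J))
  have hk_none : k ≠ none := by
    rintro rfl
    have h0 := hk 0 (by simp)
    have h1 := hk 1 (by simp)
    simp only [C, dite_eq_right_iff, reduceCtorEq, imp_false, not_not] at h0 h1
    exact hd (by linear_combination h1 - h0)
  obtain ⟨f, rfl⟩ := Option.ne_none_iff_exists'.1 hk_none
  have hmem : ∀ j : J, {s : nonzeroElements R |
      ((f : nonzeroElements R) : R) * (a + j * d) * s ∈ Subtype.val '' A} ∈ p := by
    rintro ⟨j, hj⟩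
    have hj' := hk j (by simp [hj])
    by_cases ht : a + j * d ≠ 0
    · have hcf : c ⟨a + j * d, ht⟩ = f := by
        simp only [C, dif_pos ht] at hj'
        exact congrArg Subtype.val (Option.some.inj hj')
      have := hc ⟨a + j * d, ht⟩
      rw [hcf] at this
      exact mem_of_superset this fun s hs => ⟨_, hs, rfl⟩
    · simp [C, ht] at hj'
  obtain ⟨s, hs⟩ := p.nonempty_of_mem (iInter_mem.2 hmem)
  refine ⟨(f : nonzeroElements R) * a * s, f * ⟨d, hd⟩ * s, fun j hj => ?_⟩
  have := Set.mem_iInter.1 hs ⟨j, hj⟩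
  rw [Set.mem_ofPred_eq] at this
  convert this using 1
  simp only [Submonoid.coe_mul]
  ring

/-- Members of idempotents of the multiplicative smallest ideal satisfy the conclusion of
Brauer's theorem. -/
theorem exists_affine_mem_and_mul_mem {p : Ultrafilter (nonzeroElements R)}
    (hp : p ∈ smallestIdeal (Ultrafilter (nonzeroElements R))) (hpp : p * p = p)
    {A : Set (nonzeroElements R)} (hA : A ∈ p) (h : nonzeroElements R) (J : Finset R) :
    ∃ a d : R, h * d ∈ Subtype.val '' A ∧ h * a ∈ Subtype.val '' A ∧
      ∀ j ∈ J, h * a + j * d ∈ Subtype.val '' A := by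
  classical
  have hA' := hA
  rw [← hpp, mem_ultrafilter_mul_iff] at hA'
  obtain ⟨F, hF⟩ := exists_finset_mul_mem hp hA
  let J' : Finset R := insert 0 (Finset.image₂ (fun j (f : nonzeroElements R) => j * (f : R)) J F)
  obtain ⟨a, d, had⟩ := exists_affine_mem hp (inter_mem hA' (setOf_dvd_mem hp h)) J'
  have hmem : ∀ j : J', {s : nonzeroElements R | (a + j * d) * s ∈ Subtype.val '' A} ∈ p := by
    rintro ⟨j, hj⟩
    obtain ⟨u, ⟨hu, -⟩, huj⟩ := had j hj
    rw [← huj]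
    exact mem_of_superset hu fun s hs => ⟨_, hs, rfl⟩
  obtain ⟨a', rfl⟩ : (h : R) ∣ a := by
    obtain ⟨u, ⟨-, v, hv⟩, hu⟩ := had 0 (by simp [J'])
    exact ⟨v, by simpa [hv] using hu.symm⟩
  obtain ⟨f, hf, hfp⟩ := hF (h * d)
  obtain ⟨s, hs, hsf⟩ := p.nonempty_of_mem (inter_mem (iInter_mem.2 hmem) hfp)
  have hs' : ∀ j ∈ J', (h * a' + j * d) * s ∈ Subtype.val '' A := fun j hj =>
    Set.mem_iInter.1 hs ⟨j, hj⟩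
  refine ⟨a' * s, f * d * s, ⟨_, hsf, ?_⟩, ?_, fun j hj => ?_⟩
  · simp only [Submonoid.coe_mul]
    ring
  · convert hs' 0 (by simp [J']) using 1
    ring
  · convert hs' (j * f) (Finset.mem_insert_of_mem (Finset.mem_image₂_of_mem hj hf)) using 1
    ring

end Domain

/-- Ultrafilters on `R ∖ {0}` are identified with the ultrafilters `p ≠ 0` on `R`; the third
conjunct says that `rR` belongs to `p` under this identification. -/
theorem mainTheorem5 {R : Type*} [CommRing R] [IsDomain R] [Infinite R]
    (p : Ultrafilter (nonzeroElements R))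
    (hp : p ∈ idempotentsIn (smallestIdeal (Ultrafilter (nonzeroElements R)))) :
    (∀ A ∈ p, ∀ ℓ : ℕ, ∃ b ∈ A, ∃ g ∈ A, ∀ j ≤ ℓ, b * g ^ j ∈ A) ∧
    (∀ A ∈ p, ∀ (m n : ℕ) (M : Matrix (Fin m) (Fin n) R),
      IsPartitionRegular (homogeneousSystem M) →
        ∃ x : Fin n → nonzeroElements R, (∀ j, x j ∈ A) ∧ ∀ e, homogeneousSystem M e x = 0) ∧
    (∀ r : R, r ≠ 0 → (Ideal.span {r} : Set R) ∈ Ultrafilter.map Subtype.val p) ∧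
    (∀ A ∈ p, ∀ (ℓ : ℕ) (h : R) (j : Fin ℓ → R), h ≠ 0 → (∀ i, j i ≠ 0) →
      ∃ a d : R, h * d ∈ Subtype.val '' A ∧ h * a ∈ Subtype.val '' A ∧
        ∀ i, h * a + j i * d ∈ Subtype.val '' A) := by
  obtain ⟨hpK, hpp⟩ := hp
  refine ⟨fun A hA ℓ => exists_geometric_progression hpK hpp hA ℓ, fun A hA m n M hM => ?_,
    fun r hr => ?_, fun A hA ℓ h j hh _ => ?_⟩
  · refine exists_config_of_mem_smallestIdeal (fun x => ∀ e, homogeneousSystem M e x = 0)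
      (fun s x hx e => ?_) hM hpK hA
    rw [homogeneousSystem_smul, hx e, mul_zero]
  · refine Ultrafilter.mem_map.2 (mem_of_superset (setOf_dvd_mem hpK ⟨r, hr⟩) ?_)
    rintro _ ⟨t, rfl⟩
    exact Ideal.mem_span_singleton.2 ⟨t, rfl⟩
  · classical
    obtain ⟨a, d, hd, ha, hj⟩ :=
      exists_affine_mem_and_mul_mem hpK hpp hA ⟨h, hh⟩ (Finset.univ.image j)
    exact ⟨a, d, hd, ha, fun i => hj _ (Finset.mem_image_of_mem j (Finset.mem_univ i))⟩
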